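/- Identify sets with subsets of $\omega=\{0,1,2,\dots\}$. For $A\subseteq\omega$ let $\overline\rho(A)=\limsup_n \frac{|A\cap\{0,\dots,n-1\}|}{n}$ be its upper density; $A$ has density $0$ if $\lim_n \frac{|A\cap\{0,\dots,n-1\}|}{n}=0$. A set $D$ is a coarse description of $X$ if the symmetric difference $D\triangle X$ has density $0$; write $X^{\mathfrak c}$ for the class of all sets $A$ that are computable from every coarse description of $X$, and $Y\leq_{\mathrm{nc}}X$ if every coarse description of $X$ computes a coarse description of $Y$. Let $\mathcal I(A)=\bigcup_{n\in A}[n!,(n+1)!)$, $\mathcal H(A)=\{\langle n,i\rangle : n\in A,\ i\in\omega\}$ (with $\langle\cdot,\cdot\rangle$ a standard computable pairing function), and $\mathcal E(A)=\mathcal I(\mathcal H(A))$. Let $W_0,W_1,\dots$ be the standard effective listing of the c.e. sets, with its standard stagewise finite approximations $W_e[s]$. A set $A$ is promptly simple if it is c.e. and coinfinite, and there are a computable function $f$ and a computable enumeration $A[0]\subseteq A[1]\subseteq\cdots$ of $A$ by finite sets such that for each $e$, if $W_e$ is infinite, then there are $n$ and $s$ with $n\in W_e[s]\setminus W_e[s-1]$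 and $n\in A[f(s)]$. A set is $1$-random if it is Martin-Löf random with respect to the uniform measure on $2^\omega$. Let $X\leq_{\mathrm T}\emptyset'$ be $1$-random. Then there is a promptly simple set $A$ such that, for every $D\subseteq\omega$, if $\overline\rho(D\triangle X)<\frac14$ then $A\leq_{\mathrm T}D$. In particular, $X^{\mathfrak c}$ contains a promptly simple set, and there is a promptly simple set $A$ such that $\mathcal E(A)\leq_{\mathrm{nc}}X$. -/

import Mathlib

noncomputable section

namespace Coarse

open MeasureTheory Filter
open scoped symmDiff Classical

/-! ### Turing reducibility between sets, the halting problem, c.e. sets -/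

/-- The characteristic function of a set, as a (total) function `ℕ →. ℕ`. -/
def charFun (A : Set ℕ) : ℕ →. ℕ := fun n => Part.some (if n ∈ A then 1 else 0)

/-- `A ≤_T B`: the characteristic function of `A` is computable with oracle `B`. -/
def TuringLE (A B : Set ℕ) : Prop := TuringReducible (charFun A) (charFun B)

/-- The `e`-th partial computable function. -/
def phi (e : ℕ) : ℕ →. ℕ := (Denumerable.ofNat Nat.Partrec.Code e).eval

/-- `∅'`, the halting problem `{e : φ_e(e)↓}`. -/
def zeroJump : Set ℕ := {e | (phi e e).Dom}

/-- The `e`-th c.e. set, the domain of `φ_e`. -/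
def W (e : ℕ) : Set ℕ := {n | (phi e n).Dom}

/-- `W_e[s]`: the numbers on which `φ_e` converges within the resource bound `s`. -/
def WStage (e s : ℕ) : Set ℕ :=
  {n | ((Denumerable.ofNat Nat.Partrec.Code e).evaln s n).isSome}

theorem WStage_zero (e : ℕ) : WStage e 0 = ∅ := by
  ext n; simp [WStage, Nat.Partrec.Code.evaln]

theorem WStage_mono (e : ℕ) : Monotone (WStage e) := by
  intro s t hst n hn
  obtain ⟨x, hx⟩ := Option.isSome_iff_exists.1 hn
  exact Option.isSome_iff_exists.2 ⟨x, Nat.Partrec.Code.evaln_mono hst hx⟩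

theorem WStage_finite (e s : ℕ) : (WStage e s).Finite := by
  refine (Set.finite_lt_nat s).subset fun n hn => ?_
  obtain ⟨x, hx⟩ := Option.isSome_iff_exists.1 hn
  exact Nat.Partrec.Code.evaln_bound hx

theorem iUnion_WStage (e : ℕ) : ⋃ s, WStage e s = W e := by
  ext n
  simp only [Set.mem_iUnion, WStage, W, phi, Set.mem_ofPred_eq, Part.dom_iff_mem,
    Nat.Partrec.Code.evaln_complete, Option.isSome_iff_exists, Option.mem_def]
  exact exists_comm

/-- A computable enumeration `A[0] ⊆ A[1] ⊆ ⋯` of `A` by finite sets: each `A[s]` is given,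
computably in `s`, by an explicit finite list of its elements. -/
structure IsComputableEnumeration (L : ℕ → List ℕ) (A : Set ℕ) : Prop where
  computable : Computable L
  mono : ∀ s, L s ⊆ L (s + 1)
  mem_iff : ∀ n, n ∈ A ↔ ∃ s, n ∈ L s

/-- Promptly simple sets. (Here `W_e[0] = ∅`, so that the stage `s = 0` never contributes,
whatever `s - 1` means there.) -/
def PromptlySimple (A : Set ℕ) : Prop :=
  REPred (fun n => n ∈ A) ∧ Aᶜ.Infinite ∧
    ∃ (f : ℕ → ℕ) (L : ℕ → List ℕ), Computable f ∧ IsComputableEnumeration L A ∧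
      ∀ e, (W e).Infinite → ∃ n s, n ∈ WStage e s \ WStage e (s - 1) ∧ n ∈ L (f s)

/-! ### Martin-Löf randomness -/

/-- The uniform measure on Cantor space. -/
def cantorMeasure : Measure (ℕ → Bool) :=
  Measure.infinitePi fun _ : ℕ => (PMF.uniformOfFintype Bool).toMeasure

/-- The string consisting of the first `l` bits of `Z`. -/
def initSeg (Z : ℕ → Bool) (l : ℕ) : List Bool := (List.range l).map Z

/-- The open subset of Cantor space generated by a set of strings. -/
def openOf (S : Set (List Bool)) : Set (ℕ → Bool) := {Z | ∃ l, initSeg Z l ∈ S}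

/-- A Martin-Löf test `(U_n)`, with `U_n` generated by the set of strings `S n`: the `S n` are
uniformly c.e., and `U_n` has measure at most `2 ^ (-n)`. -/
def IsMartinLofTest (S : ℕ → Set (List Bool)) : Prop :=
  REPred (fun p : ℕ × List Bool => p.2 ∈ S p.1) ∧
    ∀ n, cantorMeasure (openOf (S n)) ≤ (2⁻¹ : ENNReal) ^ n

/-- `X` is `1`-random (Martin-Löf random). -/
def IsOneRandom (X : Set ℕ) : Prop :=
  ∀ S, IsMartinLofTest S → (fun n => decide (n ∈ X)) ∉ ⋂ n, openOf (S n)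

/-! ### Density, coarse descriptions, nonuniform coarse reducibility -/

/-- `ρ_n(A) = |A ∩ {0, …, n - 1}| / n`. -/
def densityBelow (A : Set ℕ) (n : ℕ) : ℝ := (((Finset.range n).filter (· ∈ A)).card : ℝ) / n

def upperDensity (A : Set ℕ) : ℝ := limsup (densityBelow A) atTop

def lowerDensity (A : Set ℕ) : ℝ := liminf (densityBelow A) atTop

/-- `A` has density `r`. -/
def HasDensity (A : Set ℕ) (r : ℝ) : Prop := upperDensity A = r ∧ lowerDensity A = r

def IsCoarseDescription (D X : Set ℕ) : Prop := HasDensity (D ∆ X) 0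

/-- The class of all sets computable from every coarse description of `X`. -/
def coarseCone (X : Set ℕ) : Set (Set ℕ) := {A | ∀ D, IsCoarseDescription D X → TuringLE A D}

/-- `Y ≤_nc X`: every coarse description of `X` computes a coarse description of `Y`. -/
def NonuniformCoarseLE (Y X : Set ℕ) : Prop :=
  ∀ D, IsCoarseDescription D X → ∃ C, IsCoarseDescription C Y ∧ TuringLE C D

/-- `I(A) = ⋃_{n ∈ A} [n!, (n+1)!)`. -/
def factorialCode (A : Set ℕ) : Set ℕ := ⋃ n ∈ A, Set.Ico n.factorial (n + 1).factorial

/-- `H(A) = {⟨n, i⟩ : n ∈ A, i ∈ ℕ}`. -/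
def columnCode (A : Set ℕ) : Set ℕ := {m | ∃ n ∈ A, ∃ i, m = Nat.pair n i}

/-- The coarsening `E(A) = I(H(A))`. -/
def coarsening (A : Set ℕ) : Set ℕ := factorialCode (columnCode A)

end Coarse

end

noncomputable section

namespace Coarse

open MeasureTheory Filter
open scoped symmDiff Classical

/-! ### Computable functions -/

section Computability

variable {α β γ : Type*} [Primcodable α] [Primcodable β] [Primcodable γ]

/-! By the limit lemma X has a computable approximation `b`. Each e puts at most one number n into
A: one with n ≥ 2^e that enters W_e at a stage s such that `b` does not change below 2^e between n
and s. If W_e is infinite, every sufficiently large element of W_e qualifies, because `b` settles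
below 2^e; the pair ⟨n, s⟩ is recognised computably, which gives promptness. Fewer than 2^e numbers
below 2^e are used (at most e of them), so A is coinfinite.

Randomness enters through the strings b(n) restricted to 2^e, at most one for each e. By Chebyshev,
the sets at relative distance at most (1 - 2^(-k))/2 from such a string have measure at most 4^k /
2^e. These bounds are summable, so the balls form a Martin-Löf test, and for all large e the set X
lies outside the ball (`IsOneRandom.eventually_far`).

Let D differ from X with upper density below 1/4. To decide x from D, find a stage t ≥ x at which
b(t) is within (1 - 2^(-k))/4 of D at all large lengths 2^e ≤ x. If a large e put x into A through a
pair ⟨x, s⟩ with s > t, then b(x) and b(t) would agree below 2^e, and the triangle inequality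
through D would bring b(x) too close to X. So x has been enumerated by a stage computable from t,
apart from the finitely many contributions of small e (`mem_promptSet_iff_of_close`). The constant
1/4 is half of the typical distance 1/2. -/

theorem computable_fst {f : α → β × γ} (hf : Computable f) : Computable fun a => (f a).1 :=
  Computable.fst.comp hf

theorem computable_snd {f : α → β × γ} (hf : Computable f) : Computable fun a => (f a).2 :=
  Computable.snd.comp hf

theorem computable_unpair_fst {f : α → ℕ} (hf : Computable f) :
    Computable fun a => (f a).unpair.1 :=
  Computable.fst.comp (Computable.unpair.comp hf)

theorem computable_unpair_snd {f : α → ℕ} (hf : Computable f) :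
    Computable fun a => (f a).unpair.2 :=
  Computable.snd.comp (Computable.unpair.comp hf)

theorem computable_succ {f : α → ℕ} (hf : Computable f) : Computable fun a => f a + 1 :=
  Computable.succ.comp hf

theorem computable_pred {f : α → ℕ} (hf : Computable f) : Computable fun a => f a - 1 :=
  Computable.pred.comp hf

theorem computable_not {f : α → Bool} (hf : Computable f) : Computable fun a => !(f a) :=
  (Primrec.not.to_comp).comp hf

theorem computable_and {f g : α → Bool} (hf : Computable f) (hg : Computable g) :
    Computable fun a => f a && g a :=
  (Primrec.and.to_comp).comp hf hg

theorem computable_or {f g : α → Bool} (hf : Computable f) (hg : Computable g) :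
    Computable fun a => f a || g a :=
  (Primrec.or.to_comp).comp hf hg

theorem computable_decide_le {f g : α → ℕ} (hf : Computable f) (hg : Computable g) :
    Computable fun a => decide (f a ≤ g a) :=
  (Primrec.nat_le.decide.to_comp : Computable₂ fun a b : ℕ => decide (a ≤ b)).comp hf hg

theorem computable_decide_eq {f g : α → ℕ} (hf : Computable f) (hg : Computable g) :
    Computable fun a => decide (f a = g a) :=
  ((Primrec.eq (α := ℕ)).decide.to_comp : Computable₂ fun a b : ℕ => decide (a = b)).comp hf hg

theorem computable_xor {f g : α → Bool} (hf : Computable f) (hg : Computable g) :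
    Computable fun a => f a ^^ g a :=
  (Computable.cond hf (computable_not hg) hg).of_eq fun a => by cases f a <;> simp

theorem computable_add {f g : α → ℕ} (hf : Computable f) (hg : Computable g) :
    Computable fun a => f a + g a :=
  (Primrec.nat_add.to_comp).comp hf hg

theorem computable_mul {f g : α → ℕ} (hf : Computable f) (hg : Computable g) :
    Computable fun a => f a * g a :=
  (Primrec.nat_mul.to_comp).comp hf hg

theorem computable_natPair {f g : α → ℕ} (hf : Computable f) (hg : Computable g) :
    Computable fun a => Nat.pair (f a) (g a) :=
  (Primrec₂.natPair.to_comp).comp hf hg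

theorem computable_two_pow {f : α → ℕ} (hf : Computable f) : Computable fun a => 2 ^ f a := by
  refine (Computable.nat_rec hf (Computable.const 1) (h := fun _ p => 2 * p.2)
    ((computable_mul (Computable.const 2) (Computable.snd.comp Computable.snd)).to₂)).of_eq
    fun a => ?_
  induction f a with
  | zero => rfl
  | succ n ih => rw [pow_succ, mul_comm, ← ih]

theorem computable_factorial {f : α → ℕ} (hf : Computable f) :
    Computable fun a => (f a).factorial := by
  refine (Computable.nat_rec hf (Computable.const 1) (h := fun _ p => (p.1 + 1) * p.2)
    ((computable_mul (Computable.succ.comp (Computable.fst.comp Computable.snd))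
      (Computable.snd.comp Computable.snd)).to₂)).of_eq fun a => ?_
  induction f a with
  | zero => rfl
  | succ n ih => simp only [ih, Nat.factorial_succ]

/-- Bounded universal quantification. -/
def allBelow (f : ℕ → Bool) (n : ℕ) : Bool := Nat.rec true (fun i r => f i && r) n

theorem allBelow_iff {f : ℕ → Bool} {n : ℕ} : allBelow f n = true ↔ ∀ i < n, f i = true := by
  induction n with
  | zero => simp [allBelow]
  | succ n ih =>
    change (f n && allBelow f n) = true ↔ _
    rw [Bool.and_eq_true, ih]
    constructor
    · rintro ⟨h1, h2⟩ i hi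
      rcases Nat.lt_succ_iff_lt_or_eq.1 hi with h | rfl
      exacts [h2 i h, h1]
    · exact fun h => ⟨h n n.lt_succ_self, fun i hi => h i (hi.trans n.lt_succ_self)⟩

theorem computable_allBelow {f : α → ℕ → Bool} {n : α → ℕ} (hf : Computable₂ f)
    (hn : Computable n) : Computable fun a => allBelow (f a) (n a) :=
  Computable.nat_rec hn (Computable.const true) (h := fun a p => f a p.1 && p.2)
    ((computable_and (hf.comp Computable.fst (Computable.fst.comp Computable.snd))
      (Computable.snd.comp Computable.snd)).to₂)

theorem computable_count {f : α → ℕ → Bool} {n : α → ℕ} (hf : Computable₂ f)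
    (hn : Computable n) : Computable fun a => Nat.count (fun i => f a i = true) (n a) := by
  refine (Computable.nat_rec hn (Computable.const 0)
    (h := fun a p => cond (f a p.1) (p.2 + 1) p.2)
    ((Computable.cond (hf.comp Computable.fst (Computable.fst.comp Computable.snd))
      (Computable.succ.comp (Computable.snd.comp Computable.snd))
      (Computable.snd.comp Computable.snd)).to₂)).of_eq fun a => ?_
  induction n a with
  | zero => rfl
  | succ n ih =>
    simp only [ih, Nat.count_succ]
    cases f a n <;> simp

theorem computable_decide_mem {l : α → List ℕ} {n : α → ℕ} (hl : Computable l)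
    (hn : Computable n) : Computable fun a => decide (n a ∈ l a) := by
  have hn' := hn.comp (Computable.fst (α := α) (β := ℕ))
  -- The default `n + 1` at indices outside the list can never equal the number sought.
  have h := computable_not (computable_decide_eq (Computable.option_getD
    (Computable.list_getElem?.comp (hl.comp Computable.fst) Computable.snd)
    (computable_succ hn')) hn')
  refine (computable_not (computable_allBelow h.to₂ (Computable.list_length.comp hl))).of_eq
    fun a => ?_
  rw [Bool.eq_iff_iff, Bool.not_eq_true', ← Bool.not_eq_true, allBelow_iff, decide_eq_true_iff,
    List.mem_iff_getElem]
  push Not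
  refine exists_congr fun i => ?_
  constructor
  · rintro ⟨hi, h⟩
    exact ⟨hi, by simpa [hi] using h⟩
  · rintro ⟨hi, h⟩
    exact ⟨hi, by simpa [hi] using h⟩

/-- The list of all `f i`, `i < n`, for which `f i` is defined. -/
def collectBelow {β : Type*} (f : ℕ → Option β) (n : ℕ) : List β :=
  Nat.rec [] (fun i r => (f i).casesOn r fun b => b :: r) n

theorem collectBelow_succ {β : Type*} (f : ℕ → Option β) (n : ℕ) : collectBelow f (n + 1) =
    (f n).casesOn (collectBelow f n) fun b => b :: collectBelow f n := rfl

theorem mem_collectBelow {β : Type*} {f : ℕ → Option β} {n : ℕ} {b : β} :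
    b ∈ collectBelow f n ↔ ∃ i < n, f i = some b := by
  induction n with
  | zero => simp [collectBelow]
  | succ n ih =>
    rw [collectBelow_succ]
    simp only [Nat.lt_succ_iff_lt_or_eq, or_and_right, exists_or, exists_eq_left, ← ih]
    cases f n with
    | none => simp
    | some c => simp [or_comm, eq_comm]

theorem computable_collectBelow {f : α → ℕ → Option β} {n : α → ℕ} (hf : Computable₂ f)
    (hn : Computable n) : Computable fun a => collectBelow (f a) (n a) := by
  have h : Computable₂ fun (a : α) (p : ℕ × List β) =>
      (Option.casesOn (f a p.1) p.2 fun b => b :: p.2 : List β) :=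
    Computable.to₂ (Computable.option_casesOn
      (hf.comp Computable.fst (Computable.fst.comp Computable.snd))
      (Computable.snd.comp Computable.snd)
      ((Computable.list_cons.comp Computable.snd
        (Computable.snd.comp (Computable.snd.comp Computable.fst))).to₂))
  exact Computable.nat_rec hn (Computable.const []) h

theorem rePred_exists {f : α → ℕ → Bool} (hf : Computable₂ f) :
    REPred fun a => ∃ n, f a n = true := by
  refine (Partrec.dom_re (Partrec.rfind hf.partrec₂)).of_eq fun a => ?_
  rw [Nat.rfind_dom']
  constructor
  · rintro ⟨n, hn, -⟩
    exact ⟨n, (Part.mem_some_iff.1 hn).symm⟩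
  · rintro ⟨n, hn⟩
    exact ⟨n, Part.mem_some_iff.2 hn.symm, fun _ => trivial⟩

theorem computable_WStage {e s n : α → ℕ} (he : Computable e) (hs : Computable s)
    (hn : Computable n) : Computable fun a => decide (n a ∈ WStage (e a) (s a)) := by
  have h := (Primrec.option_isSome.comp Nat.Partrec.Code.primrec_evaln).to_comp.comp
    ((hs.pair ((Computable.ofNat Nat.Partrec.Code).comp he)).pair hn)
  refine h.of_eq fun p => ?_
  rw [Bool.eq_iff_iff, decide_eq_true_iff]
  rfl

theorem lt_of_mem_WStage {e s n : ℕ} (h : n ∈ WStage e s) : n < s := by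
  obtain ⟨x, hx⟩ := Option.isSome_iff_exists.1 h
  exact Nat.Partrec.Code.evaln_bound hx

end Computability

/-! ### The limit lemma -/

/-- The least zero of `u` below `s`, or `s` if there is none. -/
def boundedSearch (u : ℕ → ℕ) (s : ℕ) : ℕ :=
  Nat.rec 0 (fun _ c => cond (decide (u c = 0)) c (c + 1)) s

theorem boundedSearch_succ (u : ℕ → ℕ) (s : ℕ) : boundedSearch u (s + 1) =
    cond (decide (u (boundedSearch u s) = 0)) (boundedSearch u s) (boundedSearch u s + 1) := rfl

theorem boundedSearch_eq {u : ℕ → ℕ} {m : ℕ} (hm : u m = 0) (h : ∀ i < m, u i ≠ 0) (s : ℕ) :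
    boundedSearch u s = min s m := by
  induction s with
  | zero => simp [boundedSearch]
  | succ s ih =>
    rw [boundedSearch_succ, ih]
    rcases lt_or_ge s m with hs | hs
    · simp [min_eq_left hs.le, h s hs, Nat.succ_le_iff.2 hs]
    · simp only [min_eq_right hs, hm, min_eq_right (hs.trans s.le_succ), decide_true, cond_true]

/-- Induction on the oracle computation. Convergence is demanded only where `f` is defined; a
converging computation uses finitely many intermediate values, all of which are correct from some
stage on. -/
theorem exists_limit_approximation {O : Set (ℕ →. ℕ)}
    (hO : ∀ f ∈ O, ∃ g : ℕ → ℕ → ℕ, Computable₂ g ∧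
      ∀ n, ∀ v ∈ f n, ∀ᶠ s in atTop, g s n = v) {f : ℕ →. ℕ} (hf : Nat.RecursiveIn O f) :
    ∃ g : ℕ → ℕ → ℕ, Computable₂ g ∧ ∀ n, ∀ v ∈ f n, ∀ᶠ s in atTop, g s n = v := by
  induction hf with
  | zero =>
    refine ⟨fun _ _ => 0, Computable.const 0, fun n v hv => .of_forall fun s => ?_⟩
    exact (Part.mem_some_iff.1 hv).symm
  | succ =>
    refine ⟨fun _ n => n + 1, Computable.succ.comp Computable.snd,
      fun n v hv => .of_forall fun s => (Part.mem_some_iff.1 hv).symm⟩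
  | left =>
    refine ⟨fun _ n => n.unpair.1, Computable.fst.comp (Computable.unpair.comp Computable.snd),
      fun n v hv => .of_forall fun s => (Part.mem_some_iff.1 hv).symm⟩
  | right =>
    refine ⟨fun _ n => n.unpair.2, Computable.snd.comp (Computable.unpair.comp Computable.snd),
      fun n v hv => .of_forall fun s => (Part.mem_some_iff.1 hv).symm⟩
  | oracle f hf => exact hO f hf
  | pair _ _ ihf ihh =>
    obtain ⟨g₁, hg₁, h₁⟩ := ihf
    obtain ⟨g₂, hg₂, h₂⟩ := ihh
    refine ⟨fun s n => Nat.pair (g₁ s n) (g₂ s n), computable_natPair hg₁ hg₂, fun n v hv => ?_⟩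
    simp only [Seq.seq, Part.map_eq_map, Part.mem_bind_iff, Part.mem_map_iff] at hv
    obtain ⟨_, ⟨a, ha, rfl⟩, b, hb, rfl⟩ := hv
    filter_upwards [h₁ n a ha, h₂ n b hb] with s hs₁ hs₂
    rw [hs₁, hs₂]
  | comp _ _ ihf ihh =>
    obtain ⟨g₁, hg₁, h₁⟩ := ihf
    obtain ⟨g₂, hg₂, h₂⟩ := ihh
    refine ⟨fun s n => g₁ s (g₂ s n), hg₁.comp Computable.fst hg₂, fun n v hv => ?_⟩
    obtain ⟨a, ha, hv⟩ := Part.mem_bind_iff.1 hv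
    filter_upwards [h₁ a v hv, h₂ n a ha] with s hs₁ hs₂
    rw [hs₂, hs₁]
  | @prec f h _ _ ihf ihh =>
    obtain ⟨g₁, hg₁, h₁⟩ := ihf
    obtain ⟨g₂, hg₂, h₂⟩ := ihh
    refine ⟨fun s p => Nat.rec (g₁ s p.unpair.1)
      (fun y i => g₂ s (Nat.pair p.unpair.1 (Nat.pair y i))) p.unpair.2, ?_, fun p => ?_⟩
    · have hp : Computable fun q : ℕ × ℕ => q.2.unpair := Computable.unpair.comp Computable.snd
      have h : Computable₂ fun (q : ℕ × ℕ) (r : ℕ × ℕ) =>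
          g₂ q.1 (Nat.pair q.2.unpair.1 (Nat.pair r.1 r.2)) :=
        hg₂.comp (Computable.fst.comp Computable.fst)
          (computable_natPair ((Computable.fst.comp hp).comp Computable.fst)
            (computable_natPair (Computable.fst.comp Computable.snd)
              (Computable.snd.comp Computable.snd)))
      have hb : Computable fun q : ℕ × ℕ => g₁ q.1 q.2.unpair.1 :=
        hg₁.comp Computable.fst (Computable.fst.comp hp)
      have hn : Computable fun q : ℕ × ℕ => q.2.unpair.2 := Computable.snd.comp hp
      exact Computable.of_eq (Computable.nat_rec hn hb h) fun _ => rfl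
    · have key : ∀ (a y v : ℕ), v ∈ (Nat.rec (f a) (fun y IH => IH.bind fun i =>
          h (Nat.pair a (Nat.pair y i))) y : Part ℕ) → ∀ᶠ s in atTop,
          (Nat.rec (g₁ s a) (fun y i => g₂ s (Nat.pair a (Nat.pair y i))) y : ℕ) = v := by
        intro a y
        induction y with
        | zero => exact fun v hv => h₁ _ v hv
        | succ y ih =>
          intro v hv
          obtain ⟨i, hi, hv⟩ := Part.mem_bind_iff.1 hv
          filter_upwards [ih i hi, h₂ _ v hv] with s hs₁ hs₂
          simp only [hs₁, hs₂]
      exact key _ _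
  | @rfind f _ ihf =>
    obtain ⟨g, hg, h⟩ := ihf
    -- Cutting the search off at s keeps the approximation total; the cutoff is harmless once s
    -- reaches the true value.
    refine ⟨fun s a => boundedSearch (fun m => g s (Nat.pair a m)) s, ?_, fun a v hv => ?_⟩
    · have hc : Computable fun q : (ℕ × ℕ) × (ℕ × ℕ) => q.2.2 :=
        Computable.snd.comp Computable.snd
      have h : Computable₂ fun (q : ℕ × ℕ) (r : ℕ × ℕ) =>
          cond (decide (g q.1 (Nat.pair q.2 r.2) = 0)) r.2 (r.2 + 1) :=
        Computable.cond (computable_decide_eq (hg.comp (Computable.fst.comp Computable.fst)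
          (computable_natPair (Computable.snd.comp Computable.fst) hc)) (Computable.const 0))
          hc (Computable.succ.comp hc)
      exact Computable.nat_rec Computable.fst (Computable.const 0) h
    · obtain ⟨h0, hlt⟩ := Nat.mem_rfind.1 hv
      obtain ⟨z, hz, hz0⟩ := (Part.mem_map_iff _).1 h0
      have hz0 : z = 0 := by simpa using hz0
      subst hz0
      have hbelow : ∀ᶠ s in atTop, ∀ i < v, g s (Nat.pair a i) ≠ 0 := by
        refine (Set.finite_lt_nat v).eventually_all.2 fun i hi => ?_
        obtain ⟨w, hw, hw0⟩ := (Part.mem_map_iff _).1 (hlt hi)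
        filter_upwards [h _ w hw] with s hs
        rw [hs]
        simpa using hw0
      filter_upwards [h _ 0 hz, hbelow, eventually_ge_atTop v] with s hs₁ hs₂ hs₃
      rw [boundedSearch_eq (u := fun m => g s (Nat.pair a m)) hs₁ hs₂, min_eq_right hs₃]

/-- Sets computable from the halting problem have computable approximations. -/
theorem exists_computable_approximation {X : Set ℕ} (hX : TuringLE X zeroJump) :
    ∃ b : ℕ → ℕ → Bool, Computable₂ b ∧ ∀ n, ∀ᶠ s in atTop, b s n = decide (n ∈ X) := by
  have hX' : Nat.RecursiveIn {charFun zeroJump} (charFun X) := RecursiveIn.iff_nat.1 hX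
  have hO : ∀ f ∈ ({charFun zeroJump} : Set (ℕ →. ℕ)), ∃ g : ℕ → ℕ → ℕ, Computable₂ g ∧
      ∀ n, ∀ v ∈ f n, ∀ᶠ s in atTop, g s n = v := by
    intro f hf
    obtain rfl := Set.mem_singleton_iff.1 hf
    refine ⟨fun s n => cond (decide (n ∈ WStage n s)) 1 0,
      Computable.cond (computable_WStage Computable.snd Computable.fst Computable.snd)
        (Computable.const 1) (Computable.const 0), fun n v hv => ?_⟩
    obtain rfl := Part.mem_some_iff.1 hv
    have hn : n ∈ zeroJump ↔ n ∈ ⋃ s, WStage n s := by rw [iUnion_WStage]; rfl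
    by_cases hz : n ∈ zeroJump
    · obtain ⟨t, ht⟩ := Set.mem_iUnion.1 (hn.1 hz)
      filter_upwards [eventually_ge_atTop t] with s hs
      simp [hz, WStage_mono n hs ht]
    · refine .of_forall fun s => ?_
      have : n ∉ WStage n s := fun hs => hz (hn.2 (Set.mem_iUnion.2 ⟨s, hs⟩))
      simp [hz, this]
  obtain ⟨g, hg, h⟩ := exists_limit_approximation hO hX'
  refine ⟨fun s n => decide (g s n = 1), computable_decide_eq hg (Computable.const 1),
    fun n => ?_⟩
  filter_upwards [h n _ (Part.mem_some _)] with s hs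
  by_cases hn : n ∈ X <;> simp [hs, hn]

/-! ### Computations from initial segments of the oracle -/

theorem initSeg_succ (Z : ℕ → Bool) (l : ℕ) : initSeg Z (l + 1) = initSeg Z l ++ [Z l] := by
  simp [initSeg, List.range_succ]

/-- Primitive recursion on the length, appending one oracle bit at a time. Once the initial segment
is available as a number, the rest of a computation needs no oracle. -/
theorem recursiveIn_initSeg (D : Set ℕ) : Nat.RecursiveIn {charFun D} fun x =>
    Part.some (Encodable.encode (initSeg (fun n => decide (n ∈ D)) x)) := by
  have hstep : Partrec fun q : ℕ × ℕ => (Part.some (Encodable.encode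
      (((Encodable.decode (α := List Bool) q.1).getD []) ++ [decide (q.2 = 1)])) : Part ℕ) :=
    (Computable.encode.comp (Computable.list_concat.comp
      (Computable.option_getD (Computable.decode.comp Computable.fst) (Computable.const []))
      (computable_decide_eq Computable.snd (Computable.const 1))) : Computable _)
  have hstep' := (Partrec.recursiveIn (O := {charFun D}) hstep)
  have hD : Nat.RecursiveIn {charFun D} (charFun D) := .oracle _ rfl
  have hy : Nat.RecursiveIn {charFun D} fun q => Part.some q.unpair.2.unpair.1 := by
    have : Computable fun q : ℕ => q.unpair.2.unpair.1 := Computable.fst.comp (Computable.unpair.comp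
      (Computable.snd.comp Computable.unpair))
    exact Nat.Partrec.recursiveIn (Partrec.nat_iff.1 this.partrec)
  have hi : Nat.RecursiveIn {charFun D} fun q => Part.some q.unpair.2.unpair.2 := by
    have : Computable fun q : ℕ => q.unpair.2.unpair.2 := Computable.snd.comp (Computable.unpair.comp
      (Computable.snd.comp Computable.unpair))
    exact Nat.Partrec.recursiveIn (Partrec.nat_iff.1 this.partrec)
  have hpair : Nat.RecursiveIn {charFun D} fun x => Part.some (Nat.pair 0 x) :=
    Nat.Partrec.recursiveIn (Partrec.nat_iff.1
      (computable_natPair (Computable.const 0) Computable.id).partrec)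
  have hbase : Nat.RecursiveIn {charFun D} fun _ =>
      Part.some (Encodable.encode ([] : List Bool)) :=
    Nat.Partrec.recursiveIn (Partrec.nat_iff.1 (Computable.const _).partrec)
  refine ((Nat.RecursiveIn.prec hbase
    (Nat.RecursiveIn.comp hstep' (Nat.RecursiveIn.pair hi (Nat.RecursiveIn.comp hD hy)))).comp
    hpair).of_eq fun x => ?_
  simp only [Part.bind_eq_bind, Part.bind_some, Nat.unpair_pair]
  induction x with
  | zero => rfl
  | succ x ih =>
    have hb : (Part.some x >>= charFun D) = Part.some (if x ∈ D then 1 else 0) :=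
      Part.bind_some _ _
    simp only [ih, Part.bind_some, initSeg_succ, hb]
    by_cases hx : x ∈ D <;> simp [hx, Seq.seq]

/-- If `A(x)` can be computed from `x` and the first `x` bits of `D`, then `A ≤_T D`. -/
theorem turingLE_of_initSeg {A D : Set ℕ} {G : ℕ × List Bool →. ℕ} (hG : Partrec G)
    (h : ∀ x, G (x, initSeg (fun n => decide (n ∈ D)) x) = Part.some (if x ∈ A then 1 else 0)) :
    TuringLE A D := by
  have hid : Nat.RecursiveIn {charFun D} fun x => Part.some x :=
    Nat.Partrec.recursiveIn (Partrec.nat_iff.1 Computable.id.partrec)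
  refine RecursiveIn.iff_nat.2 ((Nat.RecursiveIn.comp (Partrec.recursiveIn (O := {charFun D}) hG)
    (Nat.RecursiveIn.pair hid (recursiveIn_initSeg D))).of_eq fun x => ?_)
  have := h x
  simp [Seq.seq, charFun, this]

/-! ### Hamming distance and the measure of Hamming balls -/

/-- The Hamming distance of the first `m` bits of `Y` and `Z`. -/
def mismatch (Y Z : ℕ → Bool) (m : ℕ) : ℕ := Nat.count (fun i => (Y i ^^ Z i) = true) m

theorem mismatch_eq_card (Y Z : ℕ → Bool) (m : ℕ) :
    mismatch Y Z m = ((Finset.range m).filter fun i => Y i ≠ Z i).card := by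
  rw [mismatch, Nat.count_eq_card_filter_range]
  congr 1
  ext i
  simp

theorem mismatch_comm (Y Z : ℕ → Bool) (m : ℕ) : mismatch Y Z m = mismatch Z Y m := by
  simp only [mismatch_eq_card, ne_comm]

theorem mismatch_triangle (Y Z V : ℕ → Bool) (m : ℕ) :
    mismatch Y V m ≤ mismatch Y Z m + mismatch Z V m := by
  simp only [mismatch_eq_card]
  refine (Finset.card_le_card fun i hi => ?_).trans (Finset.card_union_le _ _)
  simp only [Finset.mem_filter, Finset.mem_union] at hi ⊢
  by_cases h : Y i = Z i
  · exact .inr ⟨hi.1, h ▸ hi.2⟩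
  · exact .inl ⟨hi.1, h⟩

theorem mismatch_congr {Y Y' Z Z' : ℕ → Bool} {m : ℕ} (hY : ∀ i < m, Y i = Y' i)
    (hZ : ∀ i < m, Z i = Z' i) : mismatch Y Z m = mismatch Y' Z' m := by
  simp only [mismatch_eq_card]
  congr 1
  refine Finset.filter_congr fun i hi => ?_
  rw [hY i (Finset.mem_range.1 hi), hZ i (Finset.mem_range.1 hi)]

/-- The variance of a sum of independent signs. Adding a point splits each x² into (x + 1)² + (x -
1)² = 2x² + 2. -/
theorem sum_powerset_sq_deviation (t : Finset ℕ) :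
    ∑ S ∈ t.powerset, ((t.card : ℤ) - 2 * S.card) ^ 2 = (t.card : ℤ) * 2 ^ t.card := by
  induction t using Finset.induction_on with
  | empty => simp
  | insert a t ha ih =>
    rw [Finset.sum_powerset_insert ha, ← Finset.sum_add_distrib, Finset.card_insert_of_notMem ha]
    have : ∀ S ∈ t.powerset, (((t.card + 1 : ℕ) : ℤ) - 2 * S.card) ^ 2 +
        (((t.card + 1 : ℕ) : ℤ) - 2 * (insert a S).card) ^ 2 =
        2 * ((t.card : ℤ) - 2 * S.card) ^ 2 + 2 := by
      intro S hS
      rw [Finset.card_insert_of_notMem fun h => ha (Finset.mem_powerset.1 hS h)]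
      push_cast
      ring
    rw [Finset.sum_congr rfl this, Finset.sum_add_distrib, ← Finset.mul_sum, ih]
    simp only [Finset.sum_const, Finset.card_powerset, nsmul_eq_mul]
    push_cast
    ring

/-- Chebyshev's inequality: each counted S satisfies K(m - 2|S|) ≥ m, and the second moment is
known. -/
theorem card_powerset_far_from_half (m K : ℕ) :
    (((Finset.range m).powerset.filter fun S => 2 * K * S.card + m ≤ K * m).card) * m ≤
      K ^ 2 * 2 ^ m := by
  set T := (Finset.range m).powerset.filter fun S => 2 * K * S.card + m ≤ K * m with hT
  rcases Nat.eq_zero_or_pos m with rfl | hm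
  · simp
  have h1 : ∑ S ∈ T, (m : ℤ) ^ 2 ≤ ∑ S ∈ T, (K : ℤ) ^ 2 * ((m : ℤ) - 2 * S.card) ^ 2 := by
    refine Finset.sum_le_sum fun S hS => ?_
    have h : ((2 * K * S.card + m : ℕ) : ℤ) ≤ ((K * m : ℕ) : ℤ) :=
      Int.ofNat_le.2 (Finset.mem_filter.1 hS).2
    push_cast at h
    rw [← mul_pow]
    exact pow_le_pow_left₀ (by positivity) (by linarith) 2
  have h2 : ∑ S ∈ T, (K : ℤ) ^ 2 * ((m : ℤ) - 2 * S.card) ^ 2 ≤ (K : ℤ) ^ 2 * (m * 2 ^ m) := by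
    rw [← Finset.mul_sum]
    refine mul_le_mul_of_nonneg_left ?_ (by positivity)
    have := sum_powerset_sq_deviation (Finset.range m)
    rw [Finset.card_range] at this
    rw [← this]
    exact Finset.sum_le_sum_of_subset_of_nonneg (Finset.filter_subset _ _) fun _ _ _ => sq_nonneg _
  rw [Finset.sum_const, nsmul_eq_mul] at h1
  have h3 : (T.card : ℤ) * m * m ≤ (K : ℤ) ^ 2 * 2 ^ m * m := by
    calc (T.card : ℤ) * m * m = T.card * (m : ℤ) ^ 2 := by ring
      _ ≤ _ := h1.trans h2
      _ = _ := by ring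
  have h4 := le_of_mul_le_mul_right h3 (by exact_mod_cast hm)
  exact_mod_cast h4

theorem cantorMeasure_cylinder (σ : ℕ → Bool) (m : ℕ) :
    cantorMeasure {Z | ∀ i < m, Z i = σ i} = (2⁻¹ : ENNReal) ^ m := by
  have h : {Z : ℕ → Bool | ∀ i < m, Z i = σ i} =
      Set.pi (Finset.range m : Set ℕ) fun i => {σ i} := by
    ext Z
    simp [Set.pi]
  rw [h, cantorMeasure, Measure.infinitePi_pi _ fun i _ => measurableSet_singleton _]
  have : ∀ i ∈ Finset.range m, (PMF.uniformOfFintype Bool).toMeasure {σ i} = 2⁻¹ := fun i _ => by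
    rw [PMF.toMeasure_apply_singleton _ _ (measurableSet_singleton _)]
    simp
  rw [Finset.prod_congr rfl this]
  simp

/-- The ball is covered by cylinders of measure 2^(-m), one for each admissible set of positions at
which Z and Y differ. -/
theorem cantorMeasure_ball_mul_le (Y : ℕ → Bool) (m K : ℕ) :
    cantorMeasure {Z | 2 * K * mismatch Z Y m + m ≤ K * m} * m ≤ (K : ENNReal) ^ 2 := by
  set T := (Finset.range m).powerset.filter fun S => 2 * K * S.card + m ≤ K * m with hT
  have hsub : {Z | 2 * K * mismatch Z Y m + m ≤ K * m} ⊆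
      ⋃ S ∈ T, {Z : ℕ → Bool | ∀ i < m, Z i = (Y i ^^ decide (i ∈ S))} := by
    intro Z hZ
    rw [Set.mem_ofPred_eq, mismatch_eq_card] at hZ
    refine Set.mem_biUnion (Finset.mem_coe.2 (Finset.mem_filter.2
      ⟨Finset.mem_powerset.2 (Finset.filter_subset _ _), hZ⟩)) fun i hi => ?_
    by_cases h : Z i = Y i
    · simp [h]
    · simp [hi, Bool.eq_not_of_ne h]
  have hle : cantorMeasure {Z | 2 * K * mismatch Z Y m + m ≤ K * m} ≤
      T.card * (2⁻¹ : ENNReal) ^ m := by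
    refine (measure_mono hsub).trans ((measure_biUnion_finset_le _ _).trans ?_)
    simp only [cantorMeasure_cylinder, Finset.sum_const, nsmul_eq_mul, le_refl]
  have hcard : (T.card : ENNReal) * m ≤ (K : ENNReal) ^ 2 * 2 ^ m := by
    exact_mod_cast card_powerset_far_from_half m K
  calc _ ≤ T.card * (2⁻¹ : ENNReal) ^ m * m := by gcongr
    _ = T.card * m * (2⁻¹ : ENNReal) ^ m := by ring
    _ ≤ (K : ENNReal) ^ 2 * 2 ^ m * (2⁻¹ : ENNReal) ^ m := by gcongr
    _ = (K : ENNReal) ^ 2 := by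
      rw [mul_assoc, ← mul_pow, ENNReal.mul_inv_cancel (by simp) (by simp), one_pow, mul_one]

theorem cantorMeasure_ball_le (Y : ℕ → Bool) (k e : ℕ) :
    cantorMeasure {Z | 2 * 2 ^ k * mismatch Z Y (2 ^ e) + 2 ^ e ≤ 2 ^ k * 2 ^ e} ≤
      4 ^ k * (2⁻¹ : ENNReal) ^ e := by
  have h := cantorMeasure_ball_mul_le Y (2 ^ e) (2 ^ k)
  have h4 : (((2 ^ k : ℕ) : ENNReal)) ^ 2 = 4 ^ k := by
    push_cast
    rw [← pow_mul, mul_comm, pow_mul]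
    norm_num
  rw [h4] at h
  rw [← ENNReal.inv_pow, ← div_eq_mul_inv]
  refine (ENNReal.le_div_iff_mul_le (by simp) (by simp)).2 ?_
  exact_mod_cast h

/-- The shift by 2k absorbs 4^k, leaving a geometric series whose first exponent is j + 1. This
explains the threshold `j + 2 * k + 1` in the test. -/
theorem tsum_geometric_tail (k j : ℕ) :
    ∑' i : ℕ, (4 : ENNReal) ^ k * (2⁻¹ : ENNReal) ^ (j + 2 * k + 1 + i) = 2⁻¹ ^ j := by
  have h : ∀ i, (4 : ENNReal) ^ k * (2⁻¹ : ENNReal) ^ (j + 2 * k + 1 + i) =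
      2⁻¹ ^ j * 2⁻¹ * 2⁻¹ ^ i := by
    intro i
    have : (4 : ENNReal) ^ k * (2⁻¹ : ENNReal) ^ (2 * k) = 1 := by
      rw [pow_mul, ← mul_pow, ← ENNReal.inv_pow]
      norm_num
      rw [ENNReal.mul_inv_cancel (by simp) (by simp), one_pow]
    calc _ = (4 : ENNReal) ^ k * (2⁻¹ : ENNReal) ^ (2 * k) * (2⁻¹ ^ j * 2⁻¹ * 2⁻¹ ^ i) := by ring
      _ = _ := by rw [this, one_mul]
  simp_rw [h]
  rw [ENNReal.tsum_mul_left, ENNReal.tsum_geometric, ENNReal.one_sub_inv_two, inv_inv, mul_assoc,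
    ENNReal.inv_mul_cancel (by simp) (by simp), mul_one]

/-! ### The promptly simple set -/

theorem xor_eq_false {x y : Bool} : (x ^^ y) = false ↔ x = y := by cases x <;> cases y <;> simp

/-- `p = ⟨n, s⟩` is a candidate for `e` if `n ≥ 2 ^ e` enters `W_e` at stage `s` and the
approximation `b` does not change below `2 ^ e` between the stages `n` and `s`. -/
def candidate (b : ℕ → ℕ → Bool) (e p : ℕ) : Bool :=
  (decide (p.unpair.1 ∈ WStage e p.unpair.2) && !decide (p.unpair.1 ∈ WStage e (p.unpair.2 - 1))) &&
    (decide (2 ^ e ≤ p.unpair.1) && allBelow (fun t => allBelow (fun i =>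
      !decide (p.unpair.1 ≤ t) || !(b t i ^^ b p.unpair.1 i)) (2 ^ e)) (p.unpair.2 + 1))

/-- `p` is the least candidate for `e`. -/
def firstCandidate (b : ℕ → ℕ → Bool) (e p : ℕ) : Bool :=
  candidate b e p && allBelow (fun q => !candidate b e q) p

/-- Each `e` contributes the number of its least candidate. -/
def promptSet (b : ℕ → ℕ → Bool) : Set ℕ :=
  {n | ∃ e p, firstCandidate b e p = true ∧ p.unpair.1 = n}

/-- The numbers contributed by those `e` whose least candidate `p` satisfies `⟨e, p⟩ < u`. -/
def promptList (b : ℕ → ℕ → Bool) (u : ℕ) : List ℕ :=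
  collectBelow (fun q => cond (firstCandidate b q.unpair.1 q.unpair.2)
    (some q.unpair.2.unpair.1) none) u

variable {α : Type*} [Primcodable α] {b : ℕ → ℕ → Bool}

theorem candidate_iff {e p : ℕ} : candidate b e p = true ↔
    p.unpair.1 ∈ WStage e p.unpair.2 \ WStage e (p.unpair.2 - 1) ∧ 2 ^ e ≤ p.unpair.1 ∧
      ∀ t, p.unpair.1 ≤ t → t ≤ p.unpair.2 → ∀ i < 2 ^ e, b t i = b p.unpair.1 i := by
  simp only [candidate, Bool.and_eq_true, decide_eq_true_iff, Bool.not_eq_true', decide_eq_false_iff_not,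
    allBelow_iff, Bool.or_eq_true, Set.mem_sdiff, xor_eq_false, Nat.lt_succ_iff]
  refine and_congr Iff.rfl (and_congr Iff.rfl ⟨fun h t h1 h2 i hi => ?_, fun h t h2 i hi => ?_⟩)
  · exact (h t h2 i hi).resolve_left (not_not_intro h1)
  · exact or_iff_not_imp_left.2 fun h1 => h t (not_not.1 h1) h2 i hi

theorem firstCandidate_iff {e p : ℕ} : firstCandidate b e p = true ↔
    candidate b e p = true ∧ ∀ q < p, candidate b e q ≠ true := by
  simp [firstCandidate, allBelow_iff]

theorem firstCandidate_unique {e p q : ℕ} (hp : firstCandidate b e p = true)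
    (hq : firstCandidate b e q = true) : p = q := by
  rw [firstCandidate_iff] at hp hq
  rcases lt_trichotomy p q with h | h | h
  · exact absurd hp.1 (hq.2 p h)
  · exact h
  · exact absurd hq.1 (hp.2 q h)

theorem exists_firstCandidate {e p : ℕ} (hp : candidate b e p = true) :
    ∃ q, firstCandidate b e q = true :=
  ⟨Nat.find ⟨p, hp⟩, firstCandidate_iff.2 ⟨Nat.find_spec (⟨p, hp⟩ : ∃ p, candidate b e p = true),
    fun _ hq => Nat.find_min (⟨p, hp⟩ : ∃ p, candidate b e p = true) hq⟩⟩

theorem mem_promptList {u n : ℕ} : n ∈ promptList b u ↔ ∃ e p, Nat.pair e p < u ∧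
    firstCandidate b e p = true ∧ p.unpair.1 = n := by
  rw [promptList, mem_collectBelow]
  constructor
  · rintro ⟨q, hq, h⟩
    refine ⟨q.unpair.1, q.unpair.2, by rwa [Nat.pair_unpair], ?_⟩
    cases hf : firstCandidate b q.unpair.1 q.unpair.2 <;> simp_all
  · rintro ⟨e, p, hu, hf, rfl⟩
    exact ⟨_, hu, by simp [hf]⟩

theorem computable_candidate (hb : Computable₂ b) {e p : α → ℕ} (he : Computable e)
    (hp : Computable p) : Computable fun a => candidate b (e a) (p a) := by
  have hn := computable_unpair_fst hp
  have hs := computable_unpair_snd hp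
  have hpow := computable_two_pow he
  have h1 := computable_WStage he hs hn
  have h2 := computable_WStage he (computable_pred hs) hn
  have hn' := hn.comp (Computable.fst.comp (Computable.fst (α := α × ℕ) (β := ℕ)))
  have ht : Computable fun c : (α × ℕ) × ℕ => c.1.2 := computable_snd Computable.fst
  have h3 := computable_or (computable_not (computable_decide_le hn' ht))
    (computable_not (computable_xor (hb.comp ht Computable.snd) (hb.comp hn' Computable.snd)))
  have h4 := computable_allBelow h3.to₂ (hpow.comp Computable.fst)
  have h5 := computable_allBelow h4.to₂ (computable_succ hs)
  exact Computable.of_eq (computable_and (computable_and h1 (computable_not h2))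
    (computable_and (computable_decide_le hpow hn) h5)) fun _ => rfl

theorem computable_firstCandidate (hb : Computable₂ b) {e p : α → ℕ} (he : Computable e)
    (hp : Computable p) : Computable fun a => firstCandidate b (e a) (p a) := by
  have h := computable_allBelow (computable_not (computable_candidate hb
    (he.comp Computable.fst) (Computable.snd (α := α) (β := ℕ)))).to₂ hp
  exact computable_and (computable_candidate hb he hp) h

theorem computable_promptList (hb : Computable₂ b) : Computable (promptList b) := by
  have h0 : Computable fun a : ℕ × ℕ => a.2 := Computable.snd
  have h1 := computable_firstCandidate hb (computable_unpair_fst h0) (computable_unpair_snd h0)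
  have h2 := Computable.option_some.comp (computable_unpair_fst (computable_unpair_snd h0))
  exact computable_collectBelow (Computable.cond h1 h2 (Computable.const none)).to₂ Computable.id

theorem isComputableEnumeration_promptList (hb : Computable₂ b) :
    IsComputableEnumeration (promptList b) (promptSet b) where
  computable := computable_promptList hb
  mono s n hn := by
    obtain ⟨e, p, hlt, h⟩ := mem_promptList.1 hn
    exact mem_promptList.2 ⟨e, p, hlt.trans s.lt_succ_self, h⟩
  mem_iff n := by
    simp only [mem_promptList]
    exact ⟨fun ⟨e, p, h⟩ => ⟨Nat.pair e p + 1, e, p, Nat.lt_succ_self _, h⟩,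
      fun ⟨_, e, p, _, h⟩ => ⟨e, p, h⟩⟩

theorem IsComputableEnumeration.rePred {L : ℕ → List ℕ} {A : Set ℕ}
    (h : IsComputableEnumeration L A) : REPred fun n => n ∈ A := by
  have hL : Computable fun a : ℕ × ℕ => L a.2 := h.computable.comp Computable.snd
  refine (rePred_exists (computable_decide_mem hL Computable.fst).to₂).of_eq fun n => ?_
  simp only [decide_eq_true_iff, h.mem_iff]

/-- Sending a number to an index d that contributes it is injective, since d contributes only once,
and 2^d ≤ n < 2^e forces d < e. -/
theorem promptSet_card_below (b : ℕ → ℕ → Bool) (e : ℕ) :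
    ((Finset.range (2 ^ e)).filter (· ∈ promptSet b)).card ≤ e := by
  have h : ∀ n ∈ (Finset.range (2 ^ e)).filter (· ∈ promptSet b),
      ∃ d ∈ Finset.range e, ∃ p, firstCandidate b d p = true ∧ p.unpair.1 = n := by
    intro n hn
    obtain ⟨hlt, d, p, hp, rfl⟩ := Finset.mem_filter.1 hn
    have h2 := (candidate_iff.1 (firstCandidate_iff.1 hp).1).2.1
    exact ⟨d, Finset.mem_range.2 ((Nat.pow_lt_pow_iff_right Nat.one_lt_two).1
      (h2.trans_lt (Finset.mem_range.1 hlt))), p, hp, rfl⟩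
  choose! d hd p hp hn using h
  refine (Finset.card_le_card_of_injOn d hd fun m hm n hn' hmn => ?_).trans
    (Finset.card_range e).le
  have := hp m hm
  rw [hmn] at this
  rw [← hn m hm, ← hn n hn', firstCandidate_unique this (hp n hn')]

theorem promptSet_compl_infinite (b : ℕ → ℕ → Bool) : (promptSet b)ᶜ.Infinite := by
  intro hfin
  set c := hfin.toFinset.card
  -- With only c numbers outside the set, this would follow; but 2^(2c+2) is the square of 2^(c+1) >
  -- c + 1, which is too large.
  have h1 : 2 ^ (2 * c + 2) ≤ c + (2 * c + 2) := by
    have hsub : Finset.range (2 ^ (2 * c + 2)) ⊆ hfin.toFinset ∪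
        (Finset.range (2 ^ (2 * c + 2))).filter (· ∈ promptSet b) := by
      intro n hn
      by_cases h : n ∈ promptSet b
      · exact Finset.mem_union_right _ (Finset.mem_filter.2 ⟨hn, h⟩)
      · exact Finset.mem_union_left _ (hfin.mem_toFinset.2 h)
    have := (Finset.card_le_card hsub).trans (Finset.card_union_le _ _)
    rw [Finset.card_range] at this
    exact this.trans (Nat.add_le_add_left (promptSet_card_below b _) _)
  have h2 : 2 * c + 2 < 2 ^ (2 * c + 2) := Nat.lt_two_pow_self
  have h3 : c + 1 < 2 ^ (c + 1) := Nat.lt_two_pow_self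
  have h4 : 2 ^ (2 * c + 2) = 2 ^ (c + 1) * 2 ^ (c + 1) := by ring
  nlinarith

theorem eventually_stable {χ : ℕ → Bool} (h : ∀ n, ∀ᶠ s in atTop, b s n = χ n) (m : ℕ) :
    ∀ᶠ s in atTop, ∀ i < m, b s i = χ i :=
  (Set.finite_lt_nat m).eventually_all.2 fun i _ => h i

theorem exists_candidate {χ : ℕ → Bool} (h : ∀ n, ∀ᶠ s in atTop, b s n = χ n) {e : ℕ}
    (he : (W e).Infinite) : ∃ p, candidate b e p = true := by
  obtain ⟨N, hN⟩ := eventually_atTop.1 (eventually_stable h (2 ^ e))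
  obtain ⟨n, hn, hlt⟩ := he.exists_gt (max N (2 ^ e))
  rw [← iUnion_WStage, Set.mem_iUnion] at hn
  have hNn : N ≤ n := (le_max_left _ _).trans hlt.le
  refine ⟨Nat.pair n (Nat.find hn), candidate_iff.2 ?_⟩
  rw [Nat.unpair_pair]
  refine ⟨⟨Nat.find_spec hn, Nat.find_min hn ?_⟩, (le_max_right _ _).trans hlt.le,
    fun t ht _ i hi => ?_⟩
  -- The entry stage exceeds n, so it is positive and its predecessor is a genuinely earlier stage.
  · have := lt_of_mem_WStage (Nat.find_spec hn)
    omega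
  · rw [hN t (hNn.trans ht) i hi, hN n hNn i hi]

/-- Since e < 2^e ≤ n ≤ t, the code of e and its candidate is bounded computably in t alone, without
knowledge of e. This bound serves both as the promptness function and as the enumeration stage in
the reduction. -/
theorem pair_lt_of_candidate {e p t : ℕ} (hp : candidate b e p = true) (hn : p.unpair.1 ≤ t)
    (hs : p.unpair.2 ≤ t) : Nat.pair e p < Nat.pair t (Nat.pair t t) := by
  have he : e < t := (Nat.lt_two_pow_self.trans_le (candidate_iff.1 hp).2.1).trans_le hn
  have hpt : p ≤ Nat.pair t t := by
    rw [← Nat.pair_unpair p]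
    exact (StrictMono.monotone (f := fun x => Nat.pair x p.unpair.2)
      (fun _ _ h => Nat.pair_lt_pair_left _ h) hn).trans
        (StrictMono.monotone (fun _ _ h => Nat.pair_lt_pair_right _ h) hs)
  exact (Nat.pair_lt_pair_left _ he).trans_le
    (StrictMono.monotone (fun _ _ h => Nat.pair_lt_pair_right _ h) hpt)

theorem promptlySimple_promptSet (hb : Computable₂ b) {χ : ℕ → Bool}
    (h : ∀ n, ∀ᶠ s in atTop, b s n = χ n) : PromptlySimple (promptSet b) := by
  have hL := isComputableEnumeration_promptList hb
  refine ⟨hL.rePred, promptSet_compl_infinite b, fun s => Nat.pair s (Nat.pair s s), promptList b,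
    computable_natPair Computable.id (computable_natPair Computable.id Computable.id), hL,
    fun e he => ?_⟩
  obtain ⟨p, hp⟩ := exists_candidate h he
  obtain ⟨p, hp⟩ := exists_firstCandidate hp
  have hc := (firstCandidate_iff.1 hp).1
  have hW := (candidate_iff.1 hc).1
  exact ⟨p.unpair.1, p.unpair.2, hW, mem_promptList.2
    ⟨e, p, pair_lt_of_candidate hc (lt_of_mem_WStage hW.1).le le_rfl, hp, rfl⟩⟩

/-! ### Density and Hamming distance -/

theorem densityBelow_symmDiff (D X : Set ℕ) (m : ℕ) : densityBelow (D ∆ X) m =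
    (mismatch (fun n => decide (n ∈ D)) (fun n => decide (n ∈ X)) m : ℝ) / m := by
  rw [densityBelow, mismatch_eq_card]
  congr 3
  ext i
  simp only [Finset.mem_filter, Set.mem_symmDiff, ne_eq, decide_eq_decide]
  tauto

theorem densityBelow_le_one (A : Set ℕ) (m : ℕ) : densityBelow A m ≤ 1 := by
  refine div_le_one_of_le₀ ?_ (by positivity)
  have := (Finset.card_filter_le (Finset.range m) (· ∈ A))
  rw [Finset.card_range] at this
  exact_mod_cast this

theorem exists_mismatch_bound {D X : Set ℕ} (h : upperDensity (D ∆ X) < 1 / 4) :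
    ∃ k m₀ : ℕ, ∀ m ≥ m₀, 4 * 2 ^ k *
      mismatch (fun n => decide (n ∈ D)) (fun n => decide (n ∈ X)) m + m ≤ 2 ^ k * m := by
  obtain ⟨k, hk⟩ := exists_pow_lt_of_lt_one (sub_pos.2 h) (by norm_num : (1 / 2 : ℝ) < 1)
  have hr : limsup (densityBelow (D ∆ X)) atTop < 1 / 4 - (1 / 2) ^ k / 4 := by
    have : (0 : ℝ) < (1 / 2) ^ k := by positivity
    change upperDensity (D ∆ X) < _
    linarith
  have hev := eventually_lt_of_limsup_lt hr
    ⟨1, eventually_map.2 (.of_forall fun m => densityBelow_le_one _ m)⟩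
  obtain ⟨m₀, hm₀⟩ := eventually_atTop.1 hev
  -- The extra 1 excludes m = 0, where the density is a division by zero.
  refine ⟨k, m₀ + 1, fun m hm => ?_⟩
  have hlt := hm₀ m (by omega)
  have hpos : (0 : ℝ) < m := by
    have : 0 < m := by omega
    exact_mod_cast this
  rw [densityBelow_symmDiff, div_lt_iff₀ hpos] at hlt
  have h2 : (2 : ℝ) ^ k * (1 / 2) ^ k = 1 := by rw [← mul_pow]; norm_num
  have h3 : (4 * 2 ^ k * (mismatch (fun n => decide (n ∈ D)) (fun n => decide (n ∈ X)) m : ℝ) + m) ≤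
      2 ^ k * m := by
    have h4 := mul_le_mul_of_nonneg_left hlt.le (by positivity : (0 : ℝ) ≤ 4 * 2 ^ k)
    have h5 : 4 * 2 ^ k * ((1 / 4 - (1 / 2) ^ k / 4) * (m : ℝ)) =
        2 ^ k * m - (2 ^ k * (1 / 2) ^ k) * m := by ring
    rw [h5, h2] at h4
    linarith
  exact_mod_cast h3

/-! ### The Martin-Löf test -/

theorem computable_mismatch {f g : α → ℕ → Bool} {m : α → ℕ} (hf : Computable₂ f)
    (hg : Computable₂ g) (hm : Computable m) : Computable fun a => mismatch (f a) (g a) (m a) :=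
  computable_count (f := fun a i => (f a i ^^ g a i)) (computable_xor hf hg) hm

theorem computable_getD {w : α → List Bool} {i : α → ℕ} (hw : Computable w) (hi : Computable i) :
    Computable fun a => (w a)[i a]?.getD false :=
  Computable.option_getD (Computable.list_getElem?.comp hw hi) (Computable.const false)

theorem initSeg_getD (Z : ℕ → Bool) {l i : ℕ} (hi : i < l) : (initSeg Z l)[i]?.getD false = Z i := by
  simp [initSeg, hi]

/-- The strings of length `2 ^ e`, for some `e > j + 2 * k` with a least candidate `⟨n, s⟩`, that
are much closer to `b n` than a typical string. -/
def closeStrings (b : ℕ → ℕ → Bool) (k j : ℕ) : Set (List Bool) :=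
  {τ | ∃ e p, firstCandidate b e p = true ∧ τ.length = 2 ^ e ∧ j + 2 * k + 1 ≤ e ∧
    2 * 2 ^ k * mismatch (fun i => τ[i]?.getD false) (b p.unpair.1) (2 ^ e) + 2 ^ e ≤ 2 ^ k * 2 ^ e}

theorem initSeg_mem_closeStrings {Z : ℕ → Bool} {k j l : ℕ} :
    initSeg Z l ∈ closeStrings b k j ↔ ∃ e p, firstCandidate b e p = true ∧ l = 2 ^ e ∧
      j + 2 * k + 1 ≤ e ∧
      2 * 2 ^ k * mismatch Z (b p.unpair.1) (2 ^ e) + 2 ^ e ≤ 2 ^ k * 2 ^ e := by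
  refine exists_congr fun e => exists_congr fun p => and_congr_right fun _ => ?_
  have hl : (initSeg Z l).length = l := by simp [initSeg]
  rw [hl]
  refine and_congr_right fun hle => ?_
  subst hle
  rw [mismatch_congr (fun i hi => initSeg_getD Z hi) fun _ _ => rfl]

/-- Least candidates are decidable, so the strings are uniformly c.e. They are also unique, so each
e contributes at most one ball, and the measures sum to at most 2^(-j). -/
theorem isMartinLofTest_closeStrings (hb : Computable₂ b) (k : ℕ) :
    IsMartinLofTest (closeStrings b k) := by
  constructor
  · have hq : Computable fun a : (ℕ × List Bool) × ℕ => a.2 := Computable.snd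
    have hw : Computable fun a : (ℕ × List Bool) × ℕ => a.1.2 := computable_snd Computable.fst
    have hj : Computable fun a : (ℕ × List Bool) × ℕ => a.1.1 := computable_fst Computable.fst
    have he := computable_unpair_fst hq
    have hp := computable_unpair_snd hq
    have hpow := computable_two_pow he
    have hmis := computable_mismatch
      (computable_getD (hw.comp Computable.fst) Computable.snd).to₂
      (hb.comp ((computable_unpair_fst hp).comp Computable.fst) Computable.snd).to₂ hpow
    have h1 := computable_firstCandidate hb he hp
    have h2 := computable_decide_eq (Computable.list_length.comp hw) hpow
    have h3 := computable_decide_le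
      (computable_add (computable_add hj (Computable.const (2 * k))) (Computable.const 1)) he
    have h4 := computable_decide_le
      (computable_add (computable_mul (Computable.const (2 * 2 ^ k)) hmis) hpow)
      (computable_mul (Computable.const (2 ^ k)) hpow)
    refine (rePred_exists (computable_and h1 (computable_and h2
      (computable_and h3 h4))).to₂).of_eq fun a => ?_
    simp only [Bool.and_eq_true, decide_eq_true_iff]
    constructor
    · rintro ⟨q, hq⟩
      exact ⟨_, _, hq⟩
    · rintro ⟨e, p, h⟩
      refine ⟨Nat.pair e p, ?_⟩
      rw [Nat.unpair_pair]
      exact h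
  · intro j
    have hsub : openOf (closeStrings b k j) ⊆ ⋃ i, {Z | ∃ p,
        firstCandidate b (j + 2 * k + 1 + i) p = true ∧
        2 * 2 ^ k * mismatch Z (b p.unpair.1) (2 ^ (j + 2 * k + 1 + i)) + 2 ^ (j + 2 * k + 1 + i) ≤
          2 ^ k * 2 ^ (j + 2 * k + 1 + i)} := by
      rintro Z ⟨l, hl⟩
      obtain ⟨e, p, hp, -, he, h⟩ := initSeg_mem_closeStrings.1 hl
      obtain ⟨i, rfl⟩ := Nat.exists_eq_add_of_le he
      exact Set.mem_iUnion.2 ⟨i, p, hp, h⟩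
    refine (measure_mono hsub).trans ((measure_iUnion_le _).trans ?_)
    rw [← tsum_geometric_tail k j]
    refine ENNReal.tsum_le_tsum fun i => ?_
    by_cases hex : ∃ p, firstCandidate b (j + 2 * k + 1 + i) p = true
    · obtain ⟨p, hp⟩ := hex
      refine (measure_mono ?_).trans (cantorMeasure_ball_le (b p.unpair.1) k _)
      rintro Z ⟨q, hq, h⟩
      rwa [firstCandidate_unique hq hp] at h
    · refine (measure_mono_null (t := ∅) ?_ measure_empty).le.trans zero_le
      rintro Z ⟨q, hq, -⟩
      exact hex ⟨q, hq⟩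

/-- The approximation at the stage `n` at which `e` acts is eventually not close to a random set. -/
theorem IsOneRandom.eventually_far {X : Set ℕ} (hX : IsOneRandom X) (hb : Computable₂ b) (k : ℕ) :
    ∃ e₀, ∀ e ≥ e₀, ∀ p, firstCandidate b e p = true → ¬ 2 * 2 ^ k *
      mismatch (fun n => decide (n ∈ X)) (b p.unpair.1) (2 ^ e) + 2 ^ e ≤ 2 ^ k * 2 ^ e := by
  have h := hX _ (isMartinLofTest_closeStrings hb k)
  rw [Set.mem_iInter] at h
  push Not at h
  obtain ⟨j, hj⟩ := h
  exact ⟨j + 2 * k + 1, fun e he p hp hle =>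
    hj ⟨2 ^ e, initSeg_mem_closeStrings.2 ⟨e, p, hp, rfl, he, hle⟩⟩⟩

/-! ### Computing the promptly simple set -/

/-- The string `w` is close to the approximation `b t` at all lengths `2 ^ e ≤ x`, `e ≥ e₀`. -/
def closeTo (b : ℕ → ℕ → Bool) (k e₀ x : ℕ) (w : List Bool) (t : ℕ) : Bool :=
  allBelow (fun e => (!decide (e₀ ≤ e) || !decide (2 ^ e ≤ x)) ||
    decide (4 * 2 ^ k * mismatch (fun i => w[i]?.getD false) (b t) (2 ^ e) + 2 ^ e ≤
      2 ^ k * 2 ^ e)) (x + 1)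

theorem closeTo_initSeg {k e₀ x t : ℕ} {Z : ℕ → Bool} :
    closeTo b k e₀ x (initSeg Z x) t = true ↔ ∀ e ≥ e₀, 2 ^ e ≤ x →
      4 * 2 ^ k * mismatch Z (b t) (2 ^ e) + 2 ^ e ≤ 2 ^ k * 2 ^ e := by
  simp only [closeTo, allBelow_iff, Bool.or_eq_true, Bool.not_eq_true', decide_eq_false_iff_not,
    decide_eq_true_iff]
  have key : ∀ e, 2 ^ e ≤ x → mismatch (fun i => (initSeg Z x)[i]?.getD false) (b t) (2 ^ e) =
      mismatch Z (b t) (2 ^ e) := fun e he =>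
    mismatch_congr (fun i hi => initSeg_getD Z (hi.trans_le he)) fun _ _ => rfl
  constructor
  · intro h e he hx
    rw [← key e hx]
    -- Checking only e ≤ x loses nothing, since 2^e ≤ x implies e < x.
    exact (h e (Nat.lt_succ_of_lt (Nat.lt_two_pow_self.trans_le hx))).resolve_left (by tauto)
  · intro h e _
    by_cases he : e₀ ≤ e
    · by_cases hx : 2 ^ e ≤ x
      · rw [key e hx]
        exact .inr (h e he hx)
      · exact .inl (.inr hx)
    · exact .inl (.inl he)

theorem computable_closeTo (hb : Computable₂ b) (k e₀ : ℕ) {x t : α → ℕ} {w : α → List Bool}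
    (hx : Computable x) (hw : Computable w) (ht : Computable t) :
    Computable fun a => closeTo b k e₀ (x a) (w a) (t a) := by
  have he : Computable fun c : α × ℕ => c.2 := Computable.snd
  have hpow := computable_two_pow he
  have hmis := computable_mismatch
    (computable_getD ((hw.comp Computable.fst).comp Computable.fst) Computable.snd).to₂
    (hb.comp ((ht.comp (Computable.fst (α := α) (β := ℕ))).comp Computable.fst)
      Computable.snd).to₂ hpow
  have h1 := computable_not (computable_decide_le (Computable.const e₀) he)
  have h2 := computable_not (computable_decide_le hpow (hx.comp Computable.fst))
  have h3 := computable_decide_le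
    (computable_add (computable_mul (Computable.const (4 * 2 ^ k)) hmis) hpow)
    (computable_mul (Computable.const (2 ^ k)) hpow)
  exact computable_allBelow (computable_or (computable_or h1 h2) h3).to₂ (computable_succ hx)

theorem finite_contributions (b : ℕ → ℕ → Bool) (e₀ : ℕ) :
    {n | ∃ e < e₀, ∃ p, firstCandidate b e p = true ∧ p.unpair.1 = n}.Finite := by
  have h : {n | ∃ e < e₀, ∃ p, firstCandidate b e p = true ∧ p.unpair.1 = n} =
      ⋃ e ∈ {e | e < e₀}, {n | ∃ p, firstCandidate b e p = true ∧ p.unpair.1 = n} := by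
    ext n
    simp
  rw [h]
  refine (Set.finite_lt_nat e₀).biUnion fun e _ => Set.Subsingleton.finite ?_
  rintro _ ⟨p, hp, rfl⟩ _ ⟨q, hq, rfl⟩
  rw [firstCandidate_unique hp hq]

/-- A contribution x by e ≥ e₀ cannot come from a pair ⟨x, s⟩ with s > t: stability from x to s
would identify b(x) with b(t) below 2^e, and two quarter-type bounds would add up to the half-type
bound excluded by `hfar`. -/
theorem mem_promptSet_iff_of_close {X D : Set ℕ} {k e₀ : ℕ}
    (hfar : ∀ e ≥ e₀, ∀ p, firstCandidate b e p = true → ¬ 2 * 2 ^ k *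
      mismatch (fun n => decide (n ∈ X)) (b p.unpair.1) (2 ^ e) + 2 ^ e ≤ 2 ^ k * 2 ^ e)
    (hD : ∀ e ≥ e₀, 4 * 2 ^ k * mismatch (fun n => decide (n ∈ D)) (fun n => decide (n ∈ X)) (2 ^ e) +
      2 ^ e ≤ 2 ^ k * 2 ^ e) {x t : ℕ} (hxt : x ≤ t)
    (hclose : ∀ e ≥ e₀, 2 ^ e ≤ x →
      4 * 2 ^ k * mismatch (fun n => decide (n ∈ D)) (b t) (2 ^ e) + 2 ^ e ≤ 2 ^ k * 2 ^ e) :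
    x ∈ promptSet b ↔ x ∈ promptList b (Nat.pair t (Nat.pair t t)) ∨
      ∃ e < e₀, ∃ p, firstCandidate b e p = true ∧ p.unpair.1 = x := by
  constructor
  · rintro ⟨e, p, hp, rfl⟩
    rcases lt_or_ge e e₀ with he | he
    · exact .inr ⟨e, he, p, hp, rfl⟩
    have hc := (firstCandidate_iff.1 hp).1
    rcases le_or_gt p.unpair.2 t with hs | hs
    · exact .inl (mem_promptList.2 ⟨e, p, pair_lt_of_candidate hc hxt hs, hp, rfl⟩)
    · refine absurd ?_ (hfar e he p hp)
      obtain ⟨-, h2, h3⟩ := candidate_iff.1 hc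
      have h4 := hclose e he h2
      -- The stage t lies in the interval on which the candidate guarantees stability.
      rw [mismatch_congr (fun _ _ => rfl) (h3 t hxt hs.le)] at h4
      have h5 := mismatch_triangle (fun n => decide (n ∈ X)) (fun n => decide (n ∈ D))
        (b p.unpair.1) (2 ^ e)
      rw [mismatch_comm (fun n => decide (n ∈ X)) (fun n => decide (n ∈ D))] at h5
      have h6 := Nat.mul_le_mul_left (4 * 2 ^ k) h5
      rw [Nat.mul_add] at h6
      have h7 := hD e he
      have h8 : 4 * 2 ^ k * mismatch (fun n => decide (n ∈ X)) (b p.unpair.1) (2 ^ e) =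
        2 * (2 * 2 ^ k * mismatch (fun n => decide (n ∈ X)) (b p.unpair.1) (2 ^ e)) := by ring
      omega
  · rintro (h | ⟨e, -, p, hp, rfl⟩)
    · obtain ⟨e, p, -, hp, rfl⟩ := mem_promptList.1 h
      exact ⟨e, p, hp, rfl⟩
    · exact ⟨e, p, hp, rfl⟩

/-- The reduction is nonuniform: k, e₀ and the finite list of contributions by e < e₀ are built in.
The search for t halts because b(t) eventually equals X below x, and D is close to X; the stage
found need not be correct about X. -/
theorem turingLE_promptSet {X D : Set ℕ} (hX : IsOneRandom X) (hb : Computable₂ b)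
    (hlim : ∀ n, ∀ᶠ s in atTop, b s n = decide (n ∈ X)) (hD : upperDensity (D ∆ X) < 1 / 4) :
    TuringLE (promptSet b) D := by
  obtain ⟨k, m₀, hm₀⟩ := exists_mismatch_bound hD
  obtain ⟨e₁, he₁⟩ := hX.eventually_far hb k
  set e₀ := max e₁ m₀ with he₀
  have hfar := fun e (he : e ≥ e₀) => he₁ e ((le_max_left _ _).trans he)
  have hD' := fun e (he : e ≥ e₀) =>
    hm₀ (2 ^ e) (((le_max_right _ _).trans he).trans Nat.lt_two_pow_self.le)
  set F := (finite_contributions b e₀).toFinset.toList with hF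
  have hG : Partrec fun a : ℕ × List Bool =>
      -- Searching over x + t ensures that the stage found is at least x, as the stability argument
      -- requires.
      (Nat.rfind fun t => Part.some (closeTo b k e₀ a.1 a.2 (a.1 + t))).map fun t =>
        cond (decide (a.1 ∈ promptList b (Nat.pair (a.1 + t) (Nat.pair (a.1 + t) (a.1 + t)))) ||
          decide (a.1 ∈ F)) 1 0 := by
    have hx : Computable fun c : (ℕ × List Bool) × ℕ => c.1.1 := computable_fst Computable.fst
    have hw : Computable fun c : (ℕ × List Bool) × ℕ => c.1.2 := computable_snd Computable.fst
    have ht : Computable fun c : (ℕ × List Bool) × ℕ => c.1.1 + c.2 :=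
      computable_add hx Computable.snd
    have h1 := computable_closeTo hb k e₀ hx hw ht
    have h2 := computable_decide_mem ((computable_promptList hb).comp
      (computable_natPair ht (computable_natPair ht ht))) hx
    have h3 := computable_decide_mem (Computable.const F) hx
    exact Partrec.map (Partrec.rfind h1.to₂.partrec₂)
      (Computable.cond (computable_or h2 h3) (Computable.const 1) (Computable.const 0)).to₂
  refine turingLE_of_initSeg hG fun x => ?_
  obtain ⟨s, hs⟩ := (eventually_stable hlim x).exists_forall_of_atTop
  have hex : closeTo b k e₀ x (initSeg (fun n => decide (n ∈ D)) x) (x + s) = true := by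
    refine closeTo_initSeg.2 fun e he hx => ?_
    rw [mismatch_congr (fun _ _ => rfl) fun i hi => hs (x + s) (by omega) i (hi.trans_le hx)]
    exact hD' e he
  obtain ⟨t, ht, -⟩ := Nat.rfind_min'
    (p := fun t => closeTo b k e₀ x (initSeg (fun n => decide (n ∈ D)) x) (x + t)) hex
  refine Part.eq_some_iff.2 ((Part.mem_map_iff _).2 ⟨t, ht, ?_⟩)
  have hclose := closeTo_initSeg.1 (Part.mem_some_iff.1 (Nat.rfind_spec ht)).symm
  have hiff := mem_promptSet_iff_of_close hfar hD' (Nat.le_add_right x t) hclose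
  have hmemF : x ∈ F ↔ ∃ e < e₀, ∃ p, firstCandidate b e p = true ∧ p.unpair.1 = x := by
    rw [hF, Finset.mem_toList, Set.Finite.mem_toFinset]
    rfl
  rw [← hmemF] at hiff
  have hd : (decide (x ∈ promptList b (Nat.pair (x + t) (Nat.pair (x + t) (x + t)))) ||
      decide (x ∈ F)) = decide (x ∈ promptSet b) := by
    rw [Bool.eq_iff_iff]
    simp only [Bool.or_eq_true, decide_eq_true_iff, hiff]
  refine (congrArg (fun c => cond c 1 0) hd).trans ?_
  by_cases h : x ∈ promptSet b <;> simp [h]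

/-! ### The coarsening -/

/-- The largest `n ≤ m` with `n! ≤ m`. -/
def factorialIndex (m : ℕ) : ℕ := Nat.count (fun i => decide ((i + 1).factorial ≤ m) = true) m

theorem factorialIndex_eq {n m : ℕ} (h1 : n.factorial ≤ m) (h2 : m < (n + 1).factorial) :
    factorialIndex m = n := by
  have hn : n ≤ m := n.self_le_factorial.trans h1
  have h : (Finset.range m).filter (fun i => decide ((i + 1).factorial ≤ m) = true) =
      Finset.range n := by
    ext i
    simp only [Finset.mem_filter, Finset.mem_range, decide_eq_true_iff]
    constructor
    · rintro ⟨-, hi⟩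
      by_contra! hni
      exact absurd (h2.trans_le (Nat.factorial_le (Nat.succ_le_succ hni))) (not_lt.2 hi)
    -- Counting only i < m misses nothing, because n ≤ n! ≤ m.
    · exact fun hi => ⟨hi.trans_le hn, (Nat.factorial_le hi).trans h1⟩
  rw [factorialIndex, Nat.count_eq_card_filter_range, h, Finset.card_range]

theorem exists_factorial_interval {m : ℕ} (hm : 0 < m) :
    ∃ n : ℕ, n.factorial ≤ m ∧ m < (n + 1).factorial := by
  have hex : ∃ n : ℕ, m < (n + 1).factorial := ⟨m, m.lt_succ_self.trans_le (Nat.self_le_factorial _)⟩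
  refine ⟨Nat.find hex, ?_, Nat.find_spec hex⟩
  rcases Nat.eq_zero_or_eq_succ_pred (Nat.find hex) with h | h
  · rw [h]
    exact hm
  · rw [h]
    exact not_lt.1 (Nat.find_min hex (Nat.pred_lt (by omega)))

theorem mem_coarsening_iff {A : Set ℕ} {m : ℕ} :
    m ∈ coarsening A ↔ 0 < m ∧ (factorialIndex m).unpair.1 ∈ A := by
  simp only [coarsening, factorialCode, columnCode, Set.mem_iUnion, Set.mem_Ico]
  constructor
  · rintro ⟨n, ⟨a, ha, i, rfl⟩, h1, h2⟩
    refine ⟨(Nat.factorial_pos _).trans_le h1, ?_⟩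
    rwa [factorialIndex_eq h1 h2, Nat.unpair_pair]
  · rintro ⟨hm, h⟩
    obtain ⟨n, h1, h2⟩ := exists_factorial_interval hm
    rw [factorialIndex_eq h1 h2] at h
    exact ⟨n, ⟨_, h, _, (Nat.pair_unpair n).symm⟩, h1, h2⟩

theorem turingLE_coarsening (A : Set ℕ) : TuringLE (coarsening A) A := by
  have h1 : Computable fun c : ℕ × ℕ => (c.2 + 1).factorial :=
    computable_factorial (computable_succ Computable.snd)
  have hidx : Computable factorialIndex :=
    computable_count (computable_decide_le h1 Computable.fst).to₂ Computable.id
  have hq : Nat.RecursiveIn {charFun A} fun m => Part.some (factorialIndex m).unpair.1 :=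
    Nat.Partrec.recursiveIn (Partrec.nat_iff.1 (computable_unpair_fst hidx).partrec)
  have hid : Nat.RecursiveIn {charFun A} fun m => Part.some m :=
    Nat.Partrec.recursiveIn (Partrec.nat_iff.1 Computable.id.partrec)
  -- The input is paired with the oracle's answer: 0 lies in no interval [n!, (n+1)!), so it must be
  -- rejected whatever the answer is.
  have hout : Nat.RecursiveIn {charFun A} fun y => Part.some
      (cond (decide (1 ≤ y.unpair.1)) y.unpair.2 0) :=
    Nat.Partrec.recursiveIn (Partrec.nat_iff.1 (Computable.cond
      (computable_decide_le (Computable.const 1) (computable_unpair_fst Computable.id))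
      (computable_unpair_snd Computable.id) (Computable.const 0)).partrec)
  refine RecursiveIn.iff_nat.2 ((hout.comp (hid.pair
    (Nat.RecursiveIn.comp (.oracle _ rfl) hq))).of_eq fun m => ?_)
  have hb : (Part.some (factorialIndex m).unpair.1 >>= charFun A) =
    Part.some (if (factorialIndex m).unpair.1 ∈ A then 1 else 0) := Part.bind_some _ _
  rw [hb]
  simp only [charFun, mem_coarsening_iff]
  rcases Nat.eq_zero_or_pos m with rfl | hm
  · simp [Seq.seq]
  · simp [Seq.seq, hm, hm.ne']

theorem isCoarseDescription_self (X : Set ℕ) : IsCoarseDescription X X := by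
  have h : densityBelow (X ∆ X) = fun _ => 0 := by
    funext n
    simp [densityBelow]
  simp only [IsCoarseDescription, HasDensity, upperDensity, lowerDensity, h, limsup_const,
    liminf_const, and_self]

theorem TuringLE.trans {A B C : Set ℕ} (h1 : TuringLE A B) (h2 : TuringLE B C) : TuringLE A C :=
  TuringReducible.trans h1 h2

end Coarse

end

theorem mainTheorem6 (X : Set ℕ) (hX : Coarse.TuringLE X Coarse.zeroJump)
    (hrand : Coarse.IsOneRandom X) :
    (∃ A : Set ℕ, Coarse.PromptlySimple A ∧
      ∀ D : Set ℕ, Coarse.upperDensity (symmDiff D X) < 1 / 4 → Coarse.TuringLE A D) ∧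
    (∃ A ∈ Coarse.coarseCone X, Coarse.PromptlySimple A) ∧
    (∃ A : Set ℕ, Coarse.PromptlySimple A ∧
      Coarse.NonuniformCoarseLE (Coarse.coarsening A) X) := by
  obtain ⟨b, hb, hlim⟩ := Coarse.exists_computable_approximation hX
  have hps := Coarse.promptlySimple_promptSet hb hlim
  have hle : ∀ D : Set ℕ, Coarse.upperDensity (symmDiff D X) < 1 / 4 →
      Coarse.TuringLE (Coarse.promptSet b) D :=
    fun D hD => Coarse.turingLE_promptSet hrand hb hlim hD
  have hcone : ∀ D, Coarse.IsCoarseDescription D X → Coarse.TuringLE (Coarse.promptSet b) D :=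
    fun D hD => hle D (by rw [hD.1]; norm_num)
  -- A coarse description of X computes A, hence the coarsening of A exactly, which is a coarse
  -- description of itself.
  exact ⟨⟨_, hps, hle⟩, ⟨_, hcone, hps⟩, _, hps, fun D hD =>
    ⟨_, Coarse.isCoarseDescription_self _, (Coarse.turingLE_coarsening _).trans (hcone D hD)⟩⟩
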